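/- Let $q$ be a prime power, $n\ge 1$, and for $u=(u_1,u_2),\,v=(v_1,v_2)\in\mathbb F_q^{n}\times\mathbb F_q^{n}=\mathbb F_q^{2n}$ put $\langle u,v\rangle_s=\langle u_1,v_2\rangle-\langle v_1,u_2\rangle$, where $\langle x,y\rangle=\sum_i x_iy_i$. For a linear code $C\subseteq\mathbb F_q^{2n}$ let $C^{\perp_s}=\{u\in\mathbb F_q^{2n} : \langle u,v\rangle_s=0 \text{ for all } v\in C\}$, and for $c=(x,y)$ let $w_s(c)=|\{i : (x_i,y_i)\neq(0,0)\}|$. A quantum code with parameters $[[n,K,d]]$ over $\mathbb F_q$ is a subspace $Q$ of $(\mathbb C^q)^{\otimes n}$ of dimension $q^K$ with minimum distance exactly $d$: with $P$ the orthogonal projection onto $Q$, every operator $E$ that acts as the identity outside some set of fewer than $d$ tensor factors is detected, i.e. $PEP=\lambda_E P$ for some $\lambda_E\in\mathbb C$, while some operator acting as the identity outside a set of $d$ tensor factors is not detected. For $K=0$, where this condition would be empty, "detected" means, as usual, $PEP=\frac{\operatorname{tr}E}{q^n}P$. **Theorem.** Let $C\subseteq\mathbb F_q^{2n}$ be a linear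 code of dimension $k$ with $C^{\perp_s}\subseteq C$. Then $k\ge n$, and there exists a quantum code with parameters $[[n,k-n,d_s]]$ over $\mathbb F_q$, where $$d_s=\min\{w_s(c) : c\in C\setminus C^{\perp_s}\}\quad\text{if } k>n,$$ and, when $k=n$ (so that $C=C^{\perp_s}$ and the set above is empty), $d_s=\min\{w_s(c) : c\in C,\ c\ne 0\}$. -/

import Mathlib

/-- The symplectic inner product `⟨u₁, v₂⟩ - ⟨v₁, u₂⟩` of `u = (u₁, u₂)` and `v = (v₁, v₂)` in
`F ^ (2n) = F ^ n × F ^ n`. -/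
def sympInner {F : Type*} [Field F] {n : ℕ} (u v : (Fin n → F) × (Fin n → F)) : F :=
  u.1 ⬝ᵥ v.2 - v.1 ⬝ᵥ u.2

/-- The symplectic dual of a linear code of length `2n`. -/
def sympDual {F : Type*} [Field F] {n : ℕ} (C : Submodule F ((Fin n → F) × (Fin n → F))) :
    Submodule F ((Fin n → F) × (Fin n → F)) where
  carrier := {u | ∀ v ∈ C, sympInner u v = 0}
  zero_mem' := by
    intro v _
    simp [sympInner]
  add_mem' := by
    intro a b ha hb v hv
    have h1 := ha v hv
    have h2 := hb v hv
    simp only [sympInner] at h1 h2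
    simp only [sympInner, Prod.fst_add, Prod.snd_add, add_dotProduct, dotProduct_add]
    linear_combination h1 + h2
  smul_mem' := by
    intro c a ha v hv
    have h1 := ha v hv
    simp only [sympInner] at h1
    simp only [sympInner, Prod.smul_fst, Prod.smul_snd, smul_dotProduct, dotProduct_smul,
      smul_eq_mul]
    linear_combination c * h1

/-- The symplectic weight of `(x, y)`: the number of `i` with `(x i, y i) ≠ (0, 0)`. -/
def sympWeight {F : Type*} [Field F] [DecidableEq F] {n : ℕ} (c : (Fin n → F) × (Fin n → F)) : ℕ :=
  (Finset.univ.filter fun i => (c.1 i, c.2 i) ≠ (0, 0)).card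

/-- The state space `(ℂ ^ q) ^ ⊗ n` of `n` qudits of dimension `q = |F|`, with the orthonormal basis
`|x⟩ = |x₁⟩ ⊗ ⋯ ⊗ |xₙ⟩` indexed by the `x : F ^ n`. -/
abbrev QuditSpace (F : Type*) [Fintype F] (n : ℕ) : Type _ := EuclideanSpace ℂ (Fin n → F)

/-- The operator `A ⊗ 1` on `n` qudits that acts by the arbitrary operator `A` on the qudits in `S`
and by the identity on the other ones. -/
def localOp {F : Type*} [DecidableEq F] {n : ℕ} (S : Finset (Fin n))
    (A : Matrix (S → F) (S → F) ℂ) : Matrix (Fin n → F) (Fin n → F) ℂ :=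
  fun x y => if ∀ i, i ∉ S → x i = y i then A (fun i => x i) (fun i => y i) else 0

/-- The code `Q` detects the error `E`: `P E P = c P` for some scalar `c`, where `P` is the orthogonal
projection onto `Q`, written through the matrix elements between code states. -/
def Detects {F : Type*} [Fintype F] [DecidableEq F] {n : ℕ} (Q : Submodule ℂ (QuditSpace F n))
    (E : Matrix (Fin n → F) (Fin n → F) ℂ) : Prop :=
  ∃ c : ℂ, ∀ φ ∈ Q, ∀ ψ ∈ Q, inner ℂ φ (Matrix.toEuclideanLin E ψ) = c * inner ℂ φ ψ

/-- The code `Q` detects the error `E` purely: the scalar `c` is the normalized trace of `E`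
(so it is zero for a traceless error). -/
def PurelyDetects {F : Type*} [Fintype F] [DecidableEq F] {n : ℕ}
    (Q : Submodule ℂ (QuditSpace F n)) (E : Matrix (Fin n → F) (Fin n → F) ℂ) : Prop :=
  ∀ φ ∈ Q, ∀ ψ ∈ Q, inner ℂ φ (Matrix.toEuclideanLin E ψ) =
    (E.trace / (Fintype.card F : ℂ) ^ n) * inner ℂ φ ψ

/-- `Q` is a quantum code with parameters `[[n, K, d]]` over `F`, `q = |F|`: a subspace of
dimension `q ^ K` of the space of `n` qudits, whose minimum distance is exactly `d`, that is, all errors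
on fewer than `d` qudits are detected, and some error on `d` qudits is not.
A one-dimensional code (`K = 0`) detects every error in the plain sense, so there, by the usual
convention, detection is pure detection. -/
structure IsQuantumCode {F : Type*} [Fintype F] [DecidableEq F] {n : ℕ}
    (Q : Submodule ℂ (QuditSpace F n)) (K d : ℕ) : Prop where
  finrank_eq : Module.finrank ℂ Q = Fintype.card F ^ K
  detects : ∀ S : Finset (Fin n), S.card < d → ∀ A : Matrix (S → F) (S → F) ℂ,
    if K = 0 then PurelyDetects Q (localOp S A) else Detects Q (localOp S A)
  not_detects : ∃ S : Finset (Fin n), S.card = d ∧ ∃ A : Matrix (S → F) (S → F) ℂ,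
    ¬ (if K = 0 then PurelyDetects Q (localOp S A) else Detects Q (localOp S A))

/-- Commuting endomorphisms of a nonzero finite-dimensional complex vector space have a common
eigenvector. -/
lemma exists_common_eigenvector {ι : Type*} {V : Type*} [AddCommGroup V] [Module ℂ V]
    [FiniteDimensional ℂ V] [Nontrivial V] (f : ι → Module.End ℂ V)
    (hf : ∀ i j, Commute (f i) (f j)) :
    ∃ μ : ι → ℂ, ∃ v : V, v ≠ 0 ∧ ∀ i, f i v = μ i • v := by
  induction h : Module.finrank ℂ V using Nat.strong_induction_on generalizing V with
  | _ m ih =>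
  by_cases hs : ∀ i, ∃ c : ℂ, ∀ v, f i v = c • v
  · choose μ hμ using hs
    obtain ⟨v, hv⟩ := exists_ne (0 : V)
    exact ⟨μ, v, hv, fun i => hμ i v⟩
  · push Not at hs
    obtain ⟨i, hi⟩ := hs
    obtain ⟨c, hc⟩ := Module.End.exists_eigenvalue (f i)
    obtain ⟨w, hw⟩ := hi c
    have hlt : Module.finrank ℂ ((f i).eigenspace c) < m := by
      rw [← h]
      apply Submodule.finrank_lt
      intro htop
      exact hw (Module.End.mem_eigenspace_iff.mp (htop ▸ Submodule.mem_top))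
    have hmaps : ∀ j, ∀ x ∈ (f i).eigenspace c, f j x ∈ (f i).eigenspace c := by
      intro j x hx
      rw [Module.End.mem_eigenspace_iff] at hx ⊢
      have := LinearMap.congr_fun (hf i j).eq x
      simp only [Module.End.mul_apply] at this
      rw [this, hx, map_smul]
    have : Nontrivial ((f i).eigenspace c) := Submodule.nontrivial_iff_ne_bot.mpr hc
    obtain ⟨μ, v, hv, hμ⟩ := ih _ hlt (fun j => (f j).restrict (hmaps j))
      (fun j k => by
        ext x
        have := LinearMap.congr_fun (hf j k).eq x
        simpa using this) rfl
    refine ⟨μ, v, by simpa using hv, fun j => ?_⟩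
    simpa using congrArg Subtype.val (hμ j)

section Symplectic

variable {F : Type*} [Field F] {n : ℕ}

lemma sympInner_smul_right (c : F) (u v : (Fin n → F) × (Fin n → F)) :
    sympInner u (c • v) = c * sympInner u v := by
  simp [sympInner, mul_sub]

lemma sympInner_swap (u v : (Fin n → F) × (Fin n → F)) : sympInner u v = -sympInner v u := by
  simp [sympInner]

/-- The symplectic inner product as a bilinear form. -/
def sympForm (F : Type*) [Field F] (n : ℕ) :
    LinearMap.BilinForm F ((Fin n → F) × (Fin n → F)) :=
  LinearMap.mk₂ F sympInner
    (by intro a b c; simp [sympInner, add_dotProduct, dotProduct_add]; ring)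
    (by intro a b c; simp [sympInner, mul_sub])
    (by intro a b c; simp [sympInner, add_dotProduct, dotProduct_add]; ring)
    (by intro a b c; simp [sympInner, mul_sub])

@[simp]
lemma sympForm_apply (u v : (Fin n → F) × (Fin n → F)) : sympForm F n u v = sympInner u v := rfl

lemma sympForm_isRefl : (sympForm F n).IsRefl := by
  intro u v h
  rw [sympForm_apply] at h ⊢
  rw [sympInner_swap, h, neg_zero]

lemma sympForm_nondegenerate : (sympForm F n).Nondegenerate := by
  refine (LinearMap.IsRefl.nondegenerate_iff_separatingLeft (B := sympForm F n)
    sympForm_isRefl).mpr ?_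
  intro u hu
  refine Prod.ext ?_ ?_
  · refine dotProduct_eq_zero _ fun w => ?_
    simpa [sympInner] using hu (0, w)
  · refine dotProduct_eq_zero _ fun w => ?_
    simpa [sympInner, dotProduct_comm] using hu (w, 0)

lemma sympDual_eq_orthogonal (C : Submodule F ((Fin n → F) × (Fin n → F))) :
    sympDual C = (sympForm F n).orthogonal C := by
  ext u
  rw [LinearMap.BilinForm.mem_orthogonal_iff]
  refine forall₂_congr fun v _ => ?_
  rw [sympForm_apply, sympInner_swap, neg_eq_zero]

lemma sympDual_sympDual (C : Submodule F ((Fin n → F) × (Fin n → F))) :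
    sympDual (sympDual C) = C := by
  rw [sympDual_eq_orthogonal, sympDual_eq_orthogonal,
    LinearMap.BilinForm.orthogonal_orthogonal sympForm_nondegenerate sympForm_isRefl]

lemma finrank_add_finrank_sympDual (C : Submodule F ((Fin n → F) × (Fin n → F))) :
    Module.finrank F C + Module.finrank F (sympDual C) = 2 * n := by
  have h1 := LinearMap.BilinForm.finrank_orthogonal (sympForm_nondegenerate (F := F) (n := n)) C
  have h2 := Submodule.finrank_le C
  have h3 : Module.finrank F ((Fin n → F) × (Fin n → F)) = 2 * n := by
    simp [Module.finrank_prod, two_mul]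
  rw [sympDual_eq_orthogonal]
  omega

end Symplectic

section Character

variable {F : Type*} [Field F] {χ : AddChar F ℂ}

lemma exists_addChar_mul_ne_one (hχ : χ ≠ 1) {a : F} (ha : a ≠ 0) : ∃ t, χ (t * a) ≠ 1 := by
  obtain ⟨s, hs⟩ := AddChar.ne_one_iff.mp hχ
  exact ⟨s / a, by rwa [div_mul_cancel₀ _ ha]⟩

variable [Fintype F] {n : ℕ}

lemma sum_addChar_dotProduct [DecidableEq F] (hχ : χ ≠ 1) (x : Fin n → F) :
    ∑ b : Fin n → F, χ (b ⬝ᵥ x) = if x = 0 then (Fintype.card F : ℂ) ^ n else 0 := by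
  split_ifs with h
  · simp [h]
  · obtain ⟨i, hi⟩ := Function.ne_iff.mp h
    obtain ⟨t, ht⟩ := exists_addChar_mul_ne_one hχ hi
    have key : ∑ b : Fin n → F, χ (b ⬝ᵥ x) = χ (t * x i) * ∑ b : Fin n → F, χ (b ⬝ᵥ x) := by
      rw [Finset.mul_sum]
      refine Fintype.sum_equiv (Equiv.subRight (Pi.single i t)) _ _ fun b => ?_
      rw [← AddChar.map_add_eq_mul, Equiv.subRight_apply, sub_dotProduct, single_dotProduct]
      congr 1
      ring
    have h0 : (1 - χ (t * x i)) * ∑ b : Fin n → F, χ (b ⬝ᵥ x) = 0 := by linear_combination key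
    exact (mul_eq_zero.mp h0).resolve_left (sub_ne_zero.mpr (Ne.symm ht))

lemma conj_addChar (χ : AddChar F ℂ) (a : F) : (starRingEnd ℂ) (χ a) = χ (-a) := by
  rw [AddChar.map_neg_eq_conj]

end Character

lemma toEuclideanLin_mul_apply {ι : Type*} [Fintype ι] [DecidableEq ι] (A B : Matrix ι ι ℂ)
    (ψ : EuclideanSpace ℂ ι) :
    Matrix.toEuclideanLin A (Matrix.toEuclideanLin B ψ) = Matrix.toEuclideanLin (A * B) ψ := by
  simp [Matrix.toLpLin_apply]

/-- The coefficient `tr (W(u)ᴴ M) / q ^ n` of the Weyl operator `W(u)` in `M`. -/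
noncomputable def weylCoeff {F : Type*} [Field F] [Fintype F] {n : ℕ} (χ : AddChar F ℂ)
    (M : Matrix (Fin n → F) (Fin n → F) ℂ)
    (u : (Fin n → F) × (Fin n → F)) : ℂ :=
  (∑ z, χ (-(u.2 ⬝ᵥ z)) * M (z + u.1) z) / (Fintype.card F : ℂ) ^ n

lemma weylCoeff_zero {F : Type*} [Field F] [Fintype F] {n : ℕ} (χ : AddChar F ℂ)
    (M : Matrix (Fin n → F) (Fin n → F) ℂ) :
    weylCoeff χ M 0 = M.trace / (Fintype.card F : ℂ) ^ n := by
  simp [weylCoeff, Matrix.trace]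

section Weyl

variable {F : Type*} [Field F] [DecidableEq F] {n : ℕ}

/-- The Weyl operator `|y⟩ ↦ χ (u₂ ⬝ y) |y + u₁⟩` of `u = (u₁, u₂)`. -/
def weyl (χ : AddChar F ℂ) (u : (Fin n → F) × (Fin n → F)) :
    Matrix (Fin n → F) (Fin n → F) ℂ :=
  fun x y => if x = y + u.1 then χ (u.2 ⬝ᵥ y) else 0

lemma weyl_apply (χ : AddChar F ℂ) (u : (Fin n → F) × (Fin n → F)) (x y : Fin n → F) :
    weyl χ u x y = if x = y + u.1 then χ (u.2 ⬝ᵥ y) else 0 := rfl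

@[simp]
lemma weyl_zero (χ : AddChar F ℂ) : weyl χ (0 : (Fin n → F) × (Fin n → F)) = 1 := by
  ext x y
  simp [weyl, Matrix.one_apply]

/-- The set of positions where `u` is nonzero. -/
def sympSupport (u : (Fin n → F) × (Fin n → F)) : Finset (Fin n) :=
  Finset.univ.filter fun i => (u.1 i, u.2 i) ≠ (0, 0)

lemma card_sympSupport (u : (Fin n → F) × (Fin n → F)) : (sympSupport u).card = sympWeight u := rfl

/-- A Weyl operator acts on its support only. -/
lemma exists_localOp_eq_weyl (χ : AddChar F ℂ) (u : (Fin n → F) × (Fin n → F)) :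
    ∃ A, localOp (sympSupport u) A = weyl χ u := by
  have hout : ∀ i ∉ sympSupport u, u.1 i = 0 ∧ u.2 i = 0 := by
    intro i hi
    simpa [sympSupport] using hi
  refine ⟨fun (x y : sympSupport u → F) => if ∀ i, x i = y i + u.1 i then
    χ (∑ i : sympSupport u, u.2 i * y i) else 0, ?_⟩
  ext x y
  have hsum : ∑ i : sympSupport u, u.2 i * y i = u.2 ⬝ᵥ y := by
    rw [dotProduct, Finset.sum_coe_sort (sympSupport u) fun i => u.2 i * y i]
    refine Finset.sum_subset (Finset.subset_univ _) fun i _ hi => ?_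
    rw [(hout i hi).2, zero_mul]
  simp only [localOp, hsum]
  rw [weyl_apply, ← ite_and]
  refine if_congr ?_ rfl rfl
  rw [funext_iff]
  constructor
  · rintro ⟨h1, h2⟩ i
    by_cases hi : i ∈ sympSupport u
    · exact h2 ⟨i, hi⟩
    · simp [h1 i hi, (hout i hi).1]
  · intro h
    exact ⟨fun i hi => by simp [h i, (hout i hi).1], fun i => h i⟩

variable [Fintype F]

lemma weyl_mul (χ : AddChar F ℂ) (u v : (Fin n → F) × (Fin n → F)) :
    weyl χ u * weyl χ v = χ (u.2 ⬝ᵥ v.1) • weyl χ (u + v) := by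
  ext x y
  rw [Matrix.mul_apply, Finset.sum_eq_single (y + v.1)]
  · simp only [weyl_apply, Matrix.smul_apply, if_true, Prod.fst_add, Prod.snd_add, smul_eq_mul]
    rw [show y + v.1 + u.1 = y + (u.1 + v.1) by abel]
    split_ifs
    · rw [← AddChar.map_add_eq_mul, ← AddChar.map_add_eq_mul, dotProduct_add, add_dotProduct]
      congr 1
      ring
    · simp
  · intro z _ hz
    simp [weyl_apply, hz]
  · simp

lemma weyl_mul_comm (χ : AddChar F ℂ) (u v : (Fin n → F) × (Fin n → F)) :
    weyl χ u * weyl χ v = χ (sympInner v u) • (weyl χ v * weyl χ u) := by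
  rw [weyl_mul, weyl_mul, smul_smul, ← AddChar.map_add_eq_mul, add_comm v u, sympInner,
    dotProduct_comm v.2 u.1, dotProduct_comm v.1 u.2]
  congr 2
  ring

lemma weyl_conjTranspose_mul (χ : AddChar F ℂ) (u : (Fin n → F) × (Fin n → F)) :
    (weyl χ u).conjTranspose * weyl χ u = 1 := by
  ext x y
  rw [Matrix.mul_apply, Finset.sum_eq_single (y + u.1)]
  · by_cases h : x = y
    · subst h
      simp [weyl_apply, Matrix.conjTranspose_apply, conj_addChar, ← AddChar.map_add_eq_mul]
    · simp [weyl_apply, Matrix.conjTranspose_apply, h, Ne.symm h]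
  · intro z _ hz
    simp [weyl_apply, hz]
  · simp

lemma trace_weyl {χ : AddChar F ℂ} (hχ : χ ≠ 1) (u : (Fin n → F) × (Fin n → F)) :
    (weyl χ u).trace = if u = 0 then (Fintype.card F : ℂ) ^ n else 0 := by
  have h : (weyl χ u).trace = if u.1 = 0 then ∑ b : Fin n → F, χ (b ⬝ᵥ u.2) else 0 := by
    simp only [Matrix.trace, Matrix.diag_apply, weyl_apply, left_eq_add]
    split_ifs
    · simp_rw [dotProduct_comm u.2]
    · simp
  rw [h, sum_addChar_dotProduct hχ]
  simp only [Prod.ext_iff, Prod.fst_zero, Prod.snd_zero, ite_and]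

/-- The Weyl operators as endomorphisms of the state space. -/
noncomputable def weylLin (χ : AddChar F ℂ) (u : (Fin n → F) × (Fin n → F)) :
    Module.End ℂ (QuditSpace F n) :=
  Matrix.toEuclideanLin (weyl χ u)

lemma weylLin_weylLin (χ : AddChar F ℂ) (u v : (Fin n → F) × (Fin n → F)) (ψ : QuditSpace F n) :
    weylLin χ u (weylLin χ v ψ) = χ (u.2 ⬝ᵥ v.1) • weylLin χ (u + v) ψ := by
  rw [weylLin, weylLin, toEuclideanLin_mul_apply, weyl_mul, map_smul]
  rfl

lemma weylLin_comm (χ : AddChar F ℂ) (u v : (Fin n → F) × (Fin n → F)) (ψ : QuditSpace F n) :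
    weylLin χ u (weylLin χ v ψ) = χ (sympInner v u) • weylLin χ v (weylLin χ u ψ) := by
  simp only [weylLin, toEuclideanLin_mul_apply]
  rw [weyl_mul_comm, map_smul]
  rfl

lemma weylLin_zero (χ : AddChar F ℂ) (ψ : QuditSpace F n) : weylLin χ 0 ψ = ψ := by
  simp [weylLin]

lemma inner_weylLin (χ : AddChar F ℂ) (u : (Fin n → F) × (Fin n → F)) (φ ψ : QuditSpace F n) :
    inner ℂ (weylLin χ u φ) (weylLin χ u ψ) = inner ℂ φ ψ := by
  rw [← LinearMap.adjoint_inner_right, weylLin, ← Matrix.toEuclideanLin_conjTranspose_eq_adjoint,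
    toEuclideanLin_mul_apply, weyl_conjTranspose_mul]
  simp

lemma norm_weylLin (χ : AddChar F ℂ) (u : (Fin n → F) × (Fin n → F)) (ψ : QuditSpace F n) :
    ‖weylLin χ u ψ‖ = ‖ψ‖ := by
  rw [@norm_eq_sqrt_re_inner ℂ, inner_weylLin, ← @norm_eq_sqrt_re_inner ℂ]

lemma weylLin_ne_zero (χ : AddChar F ℂ) (u : (Fin n → F) × (Fin n → F)) {ψ : QuditSpace F n}
    (hψ : ψ ≠ 0) : weylLin χ u ψ ≠ 0 := by
  rw [← norm_ne_zero_iff, norm_weylLin]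
  exact norm_ne_zero_iff.mpr hψ

/-- The Weyl operators span the space of all matrices. -/
lemma sum_weylCoeff_smul_weyl {χ : AddChar F ℂ} (hχ : χ ≠ 1)
    (M : Matrix (Fin n → F) (Fin n → F) ℂ) : ∑ u, weylCoeff χ M u • weyl χ u = M := by
  have hq : (Fintype.card F : ℂ) ^ n ≠ 0 := pow_ne_zero _ (Nat.cast_ne_zero.mpr Fintype.card_ne_zero)
  ext x y
  rw [Matrix.sum_apply, Fintype.sum_prod_type, Finset.sum_eq_single (x - y)]
  · simp only [Matrix.smul_apply, weyl_apply, add_sub_cancel, if_true, smul_eq_mul, weylCoeff]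
    have h : ∀ b : Fin n → F,
        (∑ z, χ (-(b ⬝ᵥ z)) * M (z + (x - y)) z) / (Fintype.card F : ℂ) ^ n * χ (b ⬝ᵥ y) =
        ∑ z, χ (b ⬝ᵥ (y - z)) * M (z + (x - y)) z / (Fintype.card F : ℂ) ^ n := by
      intro b
      rw [div_mul_eq_mul_div, Finset.sum_mul, Finset.sum_div]
      refine Finset.sum_congr rfl fun z _ => ?_
      rw [dotProduct_sub, sub_eq_neg_add (b ⬝ᵥ y), AddChar.map_add_eq_mul]
      ring
    simp_rw [h]
    rw [Finset.sum_comm]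
    simp_rw [← Finset.sum_div, ← Finset.sum_mul, sum_addChar_dotProduct hχ, sub_eq_zero]
    simp [hq]
  · intro a _ ha
    refine Finset.sum_eq_zero fun b _ => ?_
    rw [Matrix.smul_apply, weyl_apply, if_neg, smul_zero]
    rintro rfl
    simp at ha
  · simp

/-- Operators acting on the tensor factors in `S` only involve Weyl operators supported on `S`. -/
lemma weylCoeff_localOp_eq_zero {χ : AddChar F ℂ} (hχ : χ ≠ 1) (S : Finset (Fin n))
    (A : Matrix (S → F) (S → F) ℂ) {u : (Fin n → F) × (Fin n → F)} {i : Fin n} (hi : i ∉ S)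
    (hu : (u.1 i, u.2 i) ≠ (0, 0)) : weylCoeff χ (localOp S A) u = 0 := by
  rw [weylCoeff, div_eq_zero_iff]
  left
  by_cases h1 : u.1 i = 0
  · have h2 : u.2 i ≠ 0 := fun h => hu (by rw [h1, h])
    obtain ⟨t, ht⟩ := exists_addChar_mul_ne_one hχ h2
    have key : ∑ z, χ (-(u.2 ⬝ᵥ z)) * localOp S A (z + u.1) z =
        χ (t * u.2 i) * ∑ z, χ (-(u.2 ⬝ᵥ z)) * localOp S A (z + u.1) z := by
      rw [Finset.mul_sum]
      refine Fintype.sum_equiv (Equiv.addRight (Pi.single i t)) _ _ fun z => ?_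
      rw [← mul_assoc, ← AddChar.map_add_eq_mul, Equiv.coe_addRight, dotProduct_add,
        dotProduct_single]
      congr 1
      · congr 1
        ring
      · have hS : ∀ j : S, (Pi.single i t : Fin n → F) j = 0 := fun j =>
          Pi.single_eq_of_ne (by rintro rfl; exact hi j.2) _
        simp [localOp, hS]
    have h0 : (1 - χ (t * u.2 i)) * ∑ z, χ (-(u.2 ⬝ᵥ z)) * localOp S A (z + u.1) z = 0 := by
      linear_combination key
    exact (mul_eq_zero.mp h0).resolve_left (sub_ne_zero.mpr (Ne.symm ht))
  · refine Finset.sum_eq_zero fun z _ => ?_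
    rw [localOp, if_neg, mul_zero]
    intro h
    exact h1 (by simpa using h i hi)

lemma sympWeight_le_of_weylCoeff_ne_zero {χ : AddChar F ℂ} (hχ : χ ≠ 1) (S : Finset (Fin n))
    (A : Matrix (S → F) (S → F) ℂ) {u : (Fin n → F) × (Fin n → F)}
    (h : weylCoeff χ (localOp S A) u ≠ 0) : sympWeight u ≤ S.card := by
  rw [← card_sympSupport]
  refine Finset.card_le_card fun i hi => ?_
  by_contra hiS
  exact h (weylCoeff_localOp_eq_zero hχ S A hiS (Finset.mem_filter.mp hi).2)

end Weyl

section Stabilizer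

variable {F : Type*} [Field F] [Fintype F] [DecidableEq F] {n : ℕ} {χ : AddChar F ℂ}
  {D : Submodule F ((Fin n → F) × (Fin n → F))} {μ : (Fin n → F) × (Fin n → F) → ℂ}

/-- The stabilizer code: the joint eigenspace of the Weyl operators of `u ∈ D` with eigenvalues
`μ u`. -/
def stabilizerCode (χ : AddChar F ℂ) (D : Submodule F ((Fin n → F) × (Fin n → F)))
    (μ : (Fin n → F) × (Fin n → F) → ℂ) : Submodule ℂ (QuditSpace F n) where
  carrier := {ψ | ∀ u ∈ D, weylLin χ u ψ = μ u • ψ}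
  zero_mem' := by
    intro u _
    simp
  add_mem' := by
    intro φ ψ hφ hψ u hu
    rw [map_add, hφ u hu, hψ u hu, smul_add]
  smul_mem' := by
    intro c ψ hψ u hu
    rw [map_smul, hψ u hu, smul_comm]

/-- A self-orthogonal `D` has a nonzero stabilizer code. -/
lemma exists_stabilizerCode_ne_bot (χ : AddChar F ℂ) (hD : D ≤ sympDual D) :
    ∃ μ : (Fin n → F) × (Fin n → F) → ℂ, ∃ ψ ∈ stabilizerCode χ D μ, ψ ≠ 0 := by
  obtain ⟨μ, ψ, hψ, h⟩ := exists_common_eigenvector (fun u : D => weylLin χ u.1) (by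
    intro u v
    refine LinearMap.ext fun ψ => ?_
    simp only [Module.End.mul_apply]
    rw [weylLin_comm, hD v.2 u u.2, AddChar.map_zero_eq_one, one_smul])
  classical
  refine ⟨fun u => if hu : u ∈ D then μ ⟨u, hu⟩ else 0, ψ, fun u hu => ?_, hψ⟩
  simpa [hu] using h ⟨u, hu⟩

variable {ψ : QuditSpace F n}

lemma phase_zero (hψ : ψ ∈ stabilizerCode χ D μ) (h0 : ψ ≠ 0) : μ 0 = 1 := by
  have h := hψ 0 D.zero_mem
  rw [weylLin_zero] at h
  exact smul_left_injective ℂ h0 (by simpa using h.symm)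

lemma norm_phase (hψ : ψ ∈ stabilizerCode χ D μ) (h0 : ψ ≠ 0) {u : (Fin n → F) × (Fin n → F)}
    (hu : u ∈ D) : ‖μ u‖ = 1 := by
  have h := congrArg norm (hψ u hu)
  rw [norm_weylLin, norm_smul] at h
  exact mul_right_cancel₀ (norm_ne_zero_iff.mpr h0) (by rw [one_mul, ← h])

lemma phase_ne_zero (hψ : ψ ∈ stabilizerCode χ D μ) (h0 : ψ ≠ 0)
    {u : (Fin n → F) × (Fin n → F)} (hu : u ∈ D) : μ u ≠ 0 := by
  rw [← norm_ne_zero_iff, norm_phase hψ h0 hu]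
  exact one_ne_zero

lemma phase_mul (hψ : ψ ∈ stabilizerCode χ D μ) (h0 : ψ ≠ 0) {u v : (Fin n → F) × (Fin n → F)}
    (hu : u ∈ D) (hv : v ∈ D) : μ u * μ v = χ (u.2 ⬝ᵥ v.1) * μ (u + v) := by
  have h := weylLin_weylLin χ u v ψ
  rw [hψ v hv, map_smul, hψ u hu, hψ _ (D.add_mem hu hv), smul_smul, smul_smul] at h
  rw [mul_comm]
  exact smul_left_injective ℂ h0 h

/-- Weyl operators of elements orthogonal to `D` preserve the stabilizer code. -/
lemma weylLin_mem_stabilizerCode (hψ : ψ ∈ stabilizerCode χ D μ)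
    {c : (Fin n → F) × (Fin n → F)} (hc : c ∈ sympDual D) :
    weylLin χ c ψ ∈ stabilizerCode χ D μ := by
  intro u hu
  rw [weylLin_comm, hc u hu, AddChar.map_zero_eq_one, one_smul, hψ u hu, map_smul]

/-- Weyl operators of elements not orthogonal to `D` map the stabilizer code to its orthogonal
complement. -/
lemma inner_weylLin_eq_zero (hχ : χ ≠ 1) {φ : QuditSpace F n} (hφ : φ ∈ stabilizerCode χ D μ)
    (hψ : ψ ∈ stabilizerCode χ D μ) {c : (Fin n → F) × (Fin n → F)} (hc : c ∉ sympDual D) :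
    inner ℂ φ (weylLin χ c ψ) = 0 := by
  by_cases h0 : ψ = 0
  · simp [h0]
  obtain ⟨v, hv, hcv⟩ : ∃ v ∈ D, sympInner c v ≠ 0 := by
    by_contra! h
    exact hc h
  obtain ⟨t, ht⟩ := exists_addChar_mul_ne_one hχ hcv
  have htv := D.smul_mem t hv
  have h := inner_weylLin χ (t • v) φ (weylLin χ c ψ)
  rw [weylLin_comm, sympInner_smul_right, hφ _ htv, hψ _ htv, map_smul, inner_smul_left,
    inner_smul_right, inner_smul_right] at h
  have hμ : (starRingEnd ℂ) (μ (t • v)) * μ (t • v) = 1 := by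
    rw [← Complex.normSq_eq_conj_mul_self, Complex.normSq_eq_norm_sq, norm_phase hψ h0 htv]
    simp
  have h1 : (χ (t * sympInner c v) - 1) * inner ℂ φ (weylLin χ c ψ) = 0 := by
    linear_combination h - χ (t * sympInner c v) * inner ℂ φ (weylLin χ c ψ) * hμ
  exact (mul_eq_zero.mp h1).resolve_left (sub_ne_zero.mpr ht)

lemma trace_toEuclideanLin {ι : Type*} [Fintype ι] [DecidableEq ι] (M : Matrix ι ι ℂ) :
    LinearMap.trace ℂ _ (Matrix.toEuclideanLin M) = M.trace := by
  rw [Matrix.toEuclideanLin_eq_toLin_orthonormal, Matrix.trace_toLin_eq]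

/-- The projection onto the stabilizer code. -/
noncomputable def stabilizerProj (χ : AddChar F ℂ) (D : Submodule F ((Fin n → F) × (Fin n → F)))
    [Fintype D] (μ : (Fin n → F) × (Fin n → F) → ℂ) : Module.End ℂ (QuditSpace F n) :=
  (Fintype.card D : ℂ)⁻¹ • ∑ u : D, (μ u)⁻¹ • weylLin χ u.1

lemma isProj_stabilizerProj [Fintype D] (hψ : ψ ∈ stabilizerCode χ D μ) (h0 : ψ ≠ 0) :
    LinearMap.IsProj (stabilizerCode χ D μ) (stabilizerProj χ D μ) where
  map_mem := by
    intro φ v hv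
    simp only [stabilizerProj, LinearMap.smul_apply, LinearMap.sum_apply, map_smul, map_sum]
    rw [smul_comm (μ v), Finset.smul_sum (r := μ v)]
    congr 1
    refine Fintype.sum_equiv (Equiv.addLeft (⟨v, hv⟩ : D)) _ _ fun u => ?_
    rw [weylLin_weylLin, smul_smul, smul_smul, Equiv.coe_addLeft, Submodule.coe_add]
    congr 1
    have h := phase_mul hψ h0 hv u.2
    have h1 := phase_ne_zero hψ h0 u.2
    have h2 := phase_ne_zero hψ h0 (D.add_mem hv u.2)
    field_simp
    linear_combination -h
  map_id := by
    intro φ hφ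
    simp only [stabilizerProj, LinearMap.smul_apply, LinearMap.sum_apply]
    have h : ∀ u : D, (μ u)⁻¹ • weylLin χ u.1 φ = φ := fun u => by
      rw [hφ u u.2, smul_smul, inv_mul_cancel₀ (phase_ne_zero hψ h0 u.2), one_smul]
    rw [Finset.sum_congr rfl fun u _ => h u, Finset.sum_const, Finset.card_univ,
      ← Nat.cast_smul_eq_nsmul ℂ, smul_smul,
      inv_mul_cancel₀ (Nat.cast_ne_zero.mpr Fintype.card_ne_zero), one_smul]

lemma trace_stabilizerProj [Fintype D] (hχ : χ ≠ 1) (hμ : μ 0 = 1) :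
    LinearMap.trace ℂ _ (stabilizerProj χ D μ) =
      (Fintype.card F : ℂ) ^ n / (Fintype.card D : ℂ) := by
  rw [stabilizerProj, map_smul, map_sum, Finset.sum_eq_single 0]
  · rw [map_smul, weylLin, trace_toEuclideanLin, trace_weyl hχ]
    simp [hμ, div_eq_inv_mul]
  · intro u _ hu
    rw [map_smul, weylLin, trace_toEuclideanLin, trace_weyl hχ, if_neg (by simpa using hu),
      smul_zero]
  · simp

lemma finrank_stabilizerCode (hχ : χ ≠ 1) (hψ : ψ ∈ stabilizerCode χ D μ) (h0 : ψ ≠ 0) :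
    Module.finrank ℂ (stabilizerCode χ D μ) * Fintype.card F ^ Module.finrank F D =
      Fintype.card F ^ n := by
  classical
  have hcard : Fintype.card D = Fintype.card F ^ Module.finrank F D := Module.card_eq_pow_finrank
  have h := (isProj_stabilizerProj hψ h0).trace
  rw [trace_stabilizerProj hχ (phase_zero hψ h0),
    div_eq_iff (Nat.cast_ne_zero.mpr Fintype.card_ne_zero), hcard] at h
  exact_mod_cast h.symm

/-- The matrix elements of an operator, expanded in Weyl operators. -/
lemma inner_toEuclideanLin_eq_sum (hχ : χ ≠ 1) (M : Matrix (Fin n → F) (Fin n → F) ℂ)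
    (φ ψ : QuditSpace F n) :
    inner ℂ φ (Matrix.toEuclideanLin M ψ) =
      ∑ u, weylCoeff χ M u * inner ℂ φ (weylLin χ u ψ) := by
  conv_lhs => rw [← sum_weylCoeff_smul_weyl hχ M]
  rw [map_sum, LinearMap.sum_apply, inner_sum]
  refine Finset.sum_congr rfl fun u _ => ?_
  rw [map_smul, LinearMap.smul_apply, inner_smul_right]
  rfl

lemma detects_localOp (hχ : χ ≠ 1) {S : Finset (Fin n)}
    (hS : ∀ c ∈ sympDual D, c ∉ D → S.card < sympWeight c) (A : Matrix (S → F) (S → F) ℂ) :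
    Detects (stabilizerCode χ D μ) (localOp S A) := by
  classical
  refine ⟨∑ u, if u ∈ D then weylCoeff χ (localOp S A) u * μ u else 0, fun φ hφ ψ hψ => ?_⟩
  rw [inner_toEuclideanLin_eq_sum hχ, Finset.sum_mul]
  refine Finset.sum_congr rfl fun u _ => ?_
  by_cases hu : u ∈ D
  · rw [if_pos hu, hψ u hu, inner_smul_right, mul_assoc]
  · rw [if_neg hu, zero_mul]
    by_cases hu' : u ∈ sympDual D
    · have h : weylCoeff χ (localOp S A) u = 0 := by
        by_contra h
        exact absurd (sympWeight_le_of_weylCoeff_ne_zero hχ S A h) (hS u hu' hu).not_ge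
      rw [h, zero_mul]
    · rw [inner_weylLin_eq_zero hχ hφ hψ hu', mul_zero]

lemma purelyDetects_localOp (hχ : χ ≠ 1) {S : Finset (Fin n)}
    (hS : ∀ c ∈ sympDual D, c ≠ 0 → S.card < sympWeight c) (A : Matrix (S → F) (S → F) ℂ) :
    PurelyDetects (stabilizerCode χ D μ) (localOp S A) := by
  intro φ hφ ψ hψ
  rw [inner_toEuclideanLin_eq_sum hχ, Finset.sum_eq_single 0, weylCoeff_zero, weylLin_zero]
  · intro u _ hu
    by_cases hu' : u ∈ sympDual D
    · have h : weylCoeff χ (localOp S A) u = 0 := by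
        by_contra h
        exact absurd (sympWeight_le_of_weylCoeff_ne_zero hχ S A h) (hS u hu' hu).not_ge
      rw [h, zero_mul]
    · rw [inner_weylLin_eq_zero hχ hφ hψ hu', mul_zero]
  · simp

lemma not_detects_weyl (hχ : χ ≠ 1) (hψ : ψ ∈ stabilizerCode χ D μ) (h0 : ψ ≠ 0)
    {c : (Fin n → F) × (Fin n → F)} (hc : c ∈ sympDual D) (hcD : c ∉ D) :
    ¬ Detects (stabilizerCode χ D μ) (weyl χ c) := by
  rintro ⟨a, ha⟩
  have hscalar : ∀ ψ ∈ stabilizerCode χ D μ, weylLin χ c ψ = a • ψ := by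
    intro ψ hψ
    rw [← sub_eq_zero, ← @inner_self_eq_zero ℂ]
    have hmem : weylLin χ c ψ - a • ψ ∈ stabilizerCode χ D μ :=
      Submodule.sub_mem _ (weylLin_mem_stabilizerCode hψ hc) (Submodule.smul_mem _ _ hψ)
    rw [inner_sub_right, inner_smul_right]
    exact sub_eq_zero.mpr (ha _ hmem ψ hψ)
  rw [← sympDual_sympDual D] at hcD
  obtain ⟨v, hv, hcv⟩ : ∃ v ∈ sympDual D, sympInner c v ≠ 0 := by
    by_contra! h
    exact hcD h
  obtain ⟨t, ht⟩ := exists_addChar_mul_ne_one hχ hcv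
  have hw := weylLin_mem_stabilizerCode hψ ((sympDual D).smul_mem t hv)
  have h := weylLin_comm χ (t • v) c ψ
  rw [hscalar ψ hψ, hscalar _ hw, map_smul, smul_smul, sympInner_smul_right] at h
  have h1 := smul_left_injective ℂ (weylLin_ne_zero χ (t • v) h0) h
  have ha0 : a ≠ 0 := by
    rintro rfl
    exact weylLin_ne_zero χ c h0 (by rw [hscalar ψ hψ, zero_smul])
  exact ht (mul_right_cancel₀ ha0 (by rw [← h1, one_mul]))

lemma not_purelyDetects_weyl (hχ : χ ≠ 1) (hψ : ψ ∈ stabilizerCode χ D μ) (h0 : ψ ≠ 0)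
    {c : (Fin n → F) × (Fin n → F)} (hc : c ∈ D) (hc0 : c ≠ 0) :
    ¬ PurelyDetects (stabilizerCode χ D μ) (weyl χ c) := by
  intro h
  have h1 := h ψ hψ ψ hψ
  change inner ℂ ψ (weylLin χ c ψ) = _ at h1
  rw [trace_weyl hχ, if_neg hc0, zero_div, zero_mul, hψ c hc, inner_smul_right] at h1
  exact mul_ne_zero (phase_ne_zero hψ h0 hc) (inner_self_ne_zero.mpr h0) h1

end Stabilizer

lemma exists_isLeast_image_nat {α : Type*} (f : α → ℕ) {s : Set α} (hs : s.Nonempty) :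
    ∃ d, IsLeast (f '' s) d :=
  ⟨sInf (f '' s), Nat.sInf_mem (hs.image f), fun _ h => Nat.sInf_le h⟩

theorem mainTheorem10 {F : Type*} [Field F] [Fintype F] [DecidableEq F] (n k : ℕ) (hn : 0 < n)
    (C : Submodule F ((Fin n → F) × (Fin n → F))) (hk : Module.finrank F C = k)
    (hC : sympDual C ≤ C) :
    n ≤ k ∧
    (n < k → ∃ d : ℕ,
      IsLeast (sympWeight '' {c | c ∈ C ∧ c ∉ sympDual C}) d ∧
        ∃ Q : Submodule ℂ (QuditSpace F n), IsQuantumCode Q (k - n) d) ∧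
    (k = n → ∃ d : ℕ,
      IsLeast (sympWeight '' {c | c ∈ C ∧ c ≠ 0}) d ∧
        ∃ Q : Submodule ℂ (QuditSpace F n), IsQuantumCode Q 0 d) := by
  have hdim := finrank_add_finrank_sympDual C
  have hle := Submodule.finrank_mono hC
  have hCC := sympDual_sympDual C
  have hnk : n ≤ k := by omega
  obtain ⟨χ, hχ⟩ : ∃ χ : AddChar F ℂ, χ ≠ 1 := by
    obtain ⟨χ, hχ⟩ := AddChar.exists_apply_ne_zero.mpr (one_ne_zero (α := F))
    exact ⟨χ, fun h => hχ (by simp [h])⟩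
  obtain ⟨μ, ψ, hψ, h0⟩ := exists_stabilizerCode_ne_bot (D := sympDual C) χ (by rwa [hCC])
  have hrank : Module.finrank ℂ (stabilizerCode χ (sympDual C) μ) = Fintype.card F ^ (k - n) := by
    have h := finrank_stabilizerCode hχ hψ h0
    have hpos : 0 < Fintype.card F ^ Module.finrank F (sympDual C) :=
      pow_pos Fintype.card_pos _
    refine Nat.eq_of_mul_eq_mul_right hpos ?_
    rw [h, ← pow_add]
    congr 1
    omega
  refine ⟨hnk, fun hlt => ?_, fun heq => ?_⟩
  · have hne : {c | c ∈ C ∧ c ∉ sympDual C}.Nonempty := by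
      by_contra! h
      have : C ≤ sympDual C := fun c hc => by
        by_contra hcD
        exact Set.eq_empty_iff_forall_notMem.mp h c ⟨hc, hcD⟩
      have := Submodule.finrank_mono this
      omega
    obtain ⟨d, hd⟩ := exists_isLeast_image_nat sympWeight hne
    refine ⟨d, hd, stabilizerCode χ (sympDual C) μ, hrank, fun S hS A => ?_, ?_⟩
    · rw [if_neg (by omega)]
      refine detects_localOp hχ (fun c hc hcD => hS.trans_le (hd.2 ⟨c, ⟨?_, hcD⟩, rfl⟩)) A
      rwa [hCC] at hc
    · obtain ⟨c, ⟨hc, hcD⟩, hcd⟩ := hd.1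
      obtain ⟨A, hA⟩ := exists_localOp_eq_weyl χ c
      refine ⟨sympSupport c, hcd, A, ?_⟩
      rw [if_neg (by omega), hA]
      exact not_detects_weyl hχ hψ h0 (by rwa [hCC]) hcD
  · have hself : sympDual C = C := Submodule.eq_of_le_of_finrank_eq hC (by omega)
    have hne : {c | c ∈ C ∧ c ≠ 0}.Nonempty := by
      refine (Submodule.ne_bot_iff C).mp ?_
      rintro rfl
      rw [finrank_bot] at hk
      omega
    obtain ⟨d, hd⟩ := exists_isLeast_image_nat sympWeight hne
    refine ⟨d, hd, stabilizerCode χ (sympDual C) μ, by rw [hrank, heq, Nat.sub_self],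
      fun S hS A => ?_, ?_⟩
    · rw [if_pos rfl]
      refine purelyDetects_localOp hχ (fun c hc hc0 => hS.trans_le (hd.2 ⟨c, ⟨?_, hc0⟩, rfl⟩)) A
      rwa [hCC] at hc
    · obtain ⟨c, ⟨hc, hc0⟩, hcd⟩ := hd.1
      obtain ⟨A, hA⟩ := exists_localOp_eq_weyl χ c
      refine ⟨sympSupport c, hcd, A, ?_⟩
      rw [if_pos rfl, hA]
      exact not_purelyDetects_weyl hχ hψ h0 (by rwa [hself]) hc0
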